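/- A two-step Runge--Kutta (TSRK) method with $s$ stages is given by abscissae $c_i\ge 0$ and polynomials $u_i,\tilde a_{ij},a_{ij}$ on $[0,c_i]$ and $v,\tilde b_j,b_j$ on $[0,1]$ ($i,j=1,\dots,s$) with $u_i(0)=v(0)=1$ and $\tilde a_{ij}(0)=a_{ij}(0)=\tilde b_j(0)=b_j(0)=0$. Put $c_{s+1}=1$, $u_{s+1}=v$, $\tilde a_{s+1,j}=\tilde b_j$, $a_{s+1,j}=b_j$. Let $E$ be a finite-dimensional real normed space, $r\ge 0$, $\mathcal C=C([-r,0],E)$ with the uniform norm, and $y_t(\theta)=y(t+\theta)$ for $\theta\in[-r,0]$. Consider $y'(t)=f(t,y_t)$ on $[t_0,T]$, $t_0<T$, with given initial function $y_{t_0}\in\mathcal C$, where $f:\mathbb R\times\mathcal C\to E$ is continuous and has a derivative with respect to the second argument that is bounded, and continuous in the second argument; suppose that the solution $y$ exists on $[t_0,T']$ with $T'>T$. Let $h=(T-t_0)/N$ and $t_n=t_0+nh$. For $i=1,\dots,s+1$ and $\omega\in[-r,0]$, the step $z^{[n-1]}\mapsto z^{[n]}$ of the method is $$z^{[n],i}(\omega)=\bigl(1-u_i(\tfrac\omega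 h+c_i)\bigr)z^{[n-1],s+2}+u_i(\tfrac\omega h+c_i)\,z^{[n-1],s+1}(0)+h\sum_{j=1}^s\tilde a_{ij}(\tfrac\omega h+c_i)f(t_{n-2}+c_jh,z^{[n-1],j})+h\sum_{j=1}^s a_{ij}(\tfrac\omega h+c_i)f(t_{n-1}+c_jh,z^{[n],j})$$ if $\omega\ge -c_ih$, and $z^{[n],i}(\omega)=z^{[n-1],s+1}(\omega+c_ih)$ otherwise; moreover $z^{[n],s+2}=z^{[n-1],s+1}(0)$. The exact value function is $Z^{[n]}=(y_{t_n+(c_1-1)h},\dots,y_{t_n+(c_s-1)h},y_{t_n},y(t_{n-1}))$. Let $h\,d^{[n]}$ be the residual (left side minus right side) when $z^{[n-1]},z^{[n]}$ are replaced by $Z^{[n-1]},Z^{[n]}$. The method has *uniform order of consistency* $q$ if $\max_n\|d^{[n],s+1}\|_{\mathcal C}=O(h^q)$ as $h\to0$. It has *uniform one-step order* $q$ if, for all sufficiently small $h$ and all $n$, the step with exact input $z^{[n-1]}=Z^{[n-1]}$ has a result, and all results $z^{[n]}$ of it satisfy $\|Z^{[n],s+1}-z^{[n],s+1}\|_{\mathcal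 C}=O(h^{q+1})$ uniformly in $n$. Both are required for every sufficiently smooth problem: for some $l,m$ depending only on the method and $q$, every problem as above for which the derivatives of $f$ with respect to the second argument up to order $l$ exist and are continuous on $\mathbb R\times\mathcal C$, and $y$ is piecewise $C^m$ on $[t_0,T']$. Here $n$ runs over those $n\in\{2,\dots,N\}$ for which $[t_{n-2},\,t_{n-1}+h\max(1,c_1,\dots,c_s)]$ lies in one of the closed intervals on which $y$ is $C^m$; the constant in $O(\cdot)$ may depend on the method and the problem, but not on $N$ or $n$. For $i=1,\dots,s+1$ and $k\ge1$ put $$\Gamma_{ik}(\alpha)=\frac1{(k-1)!}\Bigl[\frac{(1-u_i(\alpha))(-1)^k}{k}+\sum_{j=1}^s\tilde a_{ij}(\alpha)(-(1-c_j))^{k-1}+\sum_{j=1}^s a_{ij}(\alpha)c_j^{k-1}-\frac{\alpha^k}{k}\Bigr],\qquad \Gamma_k=\Gamma_{s+1,k}.$$ **Theorem.** Suppose that the TSRK method satisfies the stage-order-one conditions $$v(\alpha)-1+\sum_{j}\tilde b_j(\alpha)+\sum_j b_j(\alpha)=\alpha\quad(\alpha\in[0,1]),\qquad u_i(\alpha)-1+\sum_{j}\tilde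 a_{ij}(\alpha)+\sum_j a_{ij}(\alpha)=\alpha\quad(\alpha\in[0,c_i],\ i=1,\dots,s),$$ that $\Gamma_3(\alpha)=0$ for all $\alpha\in[0,1]$, and that for each distinct abscissa $c^*\in\{c_1,\dots,c_s\}$ $$\sum_{i:\,c_i=c^*}b_i(\alpha)\,\Gamma_{i2}(\beta)=0\qquad\text{for all }\alpha\in[0,1],\ \beta\in[0,c^*].$$ If the method has uniform order of consistency two, then it has uniform order of consistency three. If it has uniform one-step order two, then it has uniform one-step order three. -/

import Mathlib

open scoped NNReal

noncomputable section

/-- Coefficients of an `s`-stage two-step Runge-Kutta method for retarded functional differential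
equations, subject to the basic assumptions. Polynomial functions on `[0, c i]` or `[0, 1]` are
given by polynomials. -/
structure TSRK (s : ℕ) where
  c : Fin s → ℝ
  u : Fin s → Polynomial ℝ
  aTilde : Fin s → Fin s → Polynomial ℝ
  a : Fin s → Fin s → Polynomial ℝ
  v : Polynomial ℝ
  bTilde : Fin s → Polynomial ℝ
  b : Fin s → Polynomial ℝ
  c_nonneg : ∀ i, 0 ≤ c i
  u_zero : ∀ i, (u i).eval 0 = 1
  aTilde_zero : ∀ i j, (aTilde i j).eval 0 = 0
  a_zero : ∀ i j, (a i j).eval 0 = 0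
  v_zero : v.eval 0 = 1
  bTilde_zero : ∀ j, (bTilde j).eval 0 = 0
  b_zero : ∀ j, (b j).eval 0 = 0

/-- The space of continuous functions `[-r, 0] → E` with the uniform norm. -/
abbrev History (r : ℝ≥0) (E : Type) [NormedAddCommGroup E] : Type :=
  C(Set.Icc (-(r : ℝ)) 0, E)

/-- The point `0` of `[-r, 0]`. -/
def historyZero (r : ℝ≥0) : Set.Icc (-(r : ℝ)) 0 := ⟨0, by simp⟩

/-- The shift `y_t ∈ C([-r, 0], E)`, `y_t(θ) = y (t + θ)`. -/
def shift {E : Type} [NormedAddCommGroup E] (r : ℝ≥0) (y : C(ℝ, E)) (t : ℝ) : History r E :=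
  ⟨fun θ => y (t + (θ : ℝ)), by fun_prop⟩

/-- A system `y'(t) = f(t, y_t)` with `f` continuous and with a derivative with respect to the
second argument that is bounded, and continuous with respect to the second argument. -/
structure RFDE (E : Type) [NormedAddCommGroup E] [NormedSpace ℝ E] (r : ℝ≥0) where
  f : ℝ → History r E → E
  continuous_f : Continuous fun p : ℝ × History r E => f p.1 p.2
  contDiff_one : ∀ t, ContDiff ℝ 1 (f t)
  bounded_deriv : ∃ L : ℝ, ∀ t φ, ‖fderiv ℝ (f t) φ‖ ≤ L

/-- `f` is of class `C^l` with respect to the second argument: the derivatives with respect to the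
second argument up to order `l` exist and are continuous on `ℝ × C([-r, 0], E)`. -/
def RFDE.IsOfClass {E : Type} [NormedAddCommGroup E] [NormedSpace ℝ E] {r : ℝ≥0}
    (P : RFDE E r) (l : ℕ) : Prop :=
  (∀ t, ContDiff ℝ l (P.f t)) ∧
    ∀ k ≤ l, Continuous fun p : ℝ × History r E => iteratedFDeriv ℝ k (P.f p.1) p.2

/-- A solution of the system through `(t₀, y_{t₀})` that exists on `[t₀, tEnd]`, beyond the end
`T` of the interval of integration. The solution is a function on `[t₀ - r, tEnd]`; here it is
extended to a continuous function on `ℝ` in an arbitrary way, to which nothing below refers. -/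
structure RFDE.Solution {E : Type} [NormedAddCommGroup E] [NormedSpace ℝ E] {r : ℝ≥0}
    (P : RFDE E r) (t₀ T : ℝ) where
  y : C(ℝ, E)
  tEnd : ℝ
  t₀_lt : t₀ < T
  T_lt : T < tEnd
  isSolution : ∀ t ∈ Set.Icc t₀ tEnd,
    HasDerivWithinAt y (P.f t (shift r y t)) (Set.Icc t₀ tEnd) t

/-- `y` is of piecewise class `C^m` on `[a, b]`, with the subdivision
`a = ξ 0 < ξ 1 < ⋯ < ξ k = b`. -/
def IsPiecewiseOfClass {E : Type} [NormedAddCommGroup E] [NormedSpace ℝ E]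
    (m k : ℕ) (ξ : ℕ → ℝ) (y : ℝ → E) (a b : ℝ) : Prop :=
  ξ 0 = a ∧ ξ k = b ∧
    ∀ i < k, ξ i < ξ (i + 1) ∧ ContDiffOn ℝ m y (Set.Icc (ξ i) (ξ (i + 1)))

/-- The data `z = (z¹, …, z^{s+1}, z^{s+2})` passed from step to step: the stage functions
`seg (some i)`, the approximate solution `seg none` (component `s + 1`), and the value `prev` at
the previous mesh point (component `s + 2`, a constant function of `ω`). -/
structure StepData (s : ℕ) (r : ℝ≥0) (E : Type) [NormedAddCommGroup E] where
  seg : Option (Fin s) → History r E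
  prev : E

namespace TSRK

variable {s : ℕ} (M : TSRK s)

/-- Abscissae, with `c_{s+1} = 1` (index `none`). -/
def cExt : Option (Fin s) → ℝ
  | some i => M.c i
  | none => 1

/-- `u_i`, with `u_{s+1} = v`. -/
def uExt : Option (Fin s) → Polynomial ℝ
  | some i => M.u i
  | none => M.v

/-- `ã_{ij}`, with `ã_{s+1,j} = b̃_j`. -/
def aTildeExt : Option (Fin s) → Fin s → Polynomial ℝ
  | some i => M.aTilde i
  | none => M.bTilde

/-- `a_{ij}`, with `a_{s+1,j} = b_j`. -/
def aExt : Option (Fin s) → Fin s → Polynomial ℝ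
  | some i => M.a i
  | none => M.b

/-- `Γ_{ik}(α)` for `k ≥ 1`; `Γ_k = Γ_{s+1,k}` is `M.Gamma none k`. -/
def Gamma (i : Option (Fin s)) (k : ℕ) (α : ℝ) : ℝ :=
  (1 / ((k - 1).factorial : ℝ)) *
    ((1 - (M.uExt i).eval α) * (-1) ^ k / k
      + ∑ j, (M.aTildeExt i j).eval α * (-(1 - M.c j)) ^ (k - 1)
      + ∑ j, (M.aExt i j).eval α * M.c j ^ (k - 1)
      - α ^ k / k)

/-- The stage-order-one conditions. -/
def StageOrderOne : Prop :=
  (∀ α ∈ Set.Icc (0 : ℝ) 1,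
    M.v.eval α - 1 + ∑ j, (M.bTilde j).eval α + ∑ j, (M.b j).eval α = α) ∧
  ∀ i, ∀ α ∈ Set.Icc 0 (M.c i),
    (M.u i).eval α - 1 + ∑ j, (M.aTilde i j).eval α + ∑ j, (M.a i j).eval α = α

section
variable {E : Type} [NormedAddCommGroup E] [NormedSpace ℝ E] {r : ℝ≥0}

/-- Component `i ≤ s + 1` of the right-hand side of the method at `ω ∈ [-r, 0]`, for the step from
`t = t_{n-1}` to `t + h = t_n`, with `z = z^{[n-1]}` and `z' = z^{[n]}`. -/
def rhs (P : RFDE E r) (h t : ℝ) (z z' : StepData s r E) (i : Option (Fin s))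
    (ω : Set.Icc (-(r : ℝ)) 0) : E :=
  if -(M.cExt i * h) ≤ (ω : ℝ) then
    (1 - (M.uExt i).eval (ω / h + M.cExt i)) • z.prev
      + (M.uExt i).eval (ω / h + M.cExt i) • z.seg none (historyZero r)
      + h • ∑ j, (M.aTildeExt i j).eval (ω / h + M.cExt i) •
          P.f (t - h + M.c j * h) (z.seg (some j))
      + h • ∑ j, (M.aExt i j).eval (ω / h + M.cExt i) •
          P.f (t + M.c j * h) (z'.seg (some j))
  else z.seg none (Set.projIcc (-(r : ℝ)) 0 (by simp) (ω + M.cExt i * h))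

/-- `z'` is a result of one step of the method from `t` to `t + h` with input `z`. -/
def IsStep (P : RFDE E r) (h t : ℝ) (z z' : StepData s r E) : Prop :=
  (∀ i ω, z'.seg i ω = M.rhs P h t z z' i ω) ∧ z'.prev = z.seg none (historyZero r)

/-- The exact value function `Z^{[n]}` at `t = t_n`: its components are `y_{t_n + (c_i - 1) h}` for
`i ≤ s + 1`, and `y (t_{n-1})`. -/
def exactValue (y : C(ℝ, E)) (h t : ℝ) : StepData s r E where
  seg i := shift r y (t + (M.cExt i - 1) * h)
  prev := y (t - h)

/-- Component `i ≤ s + 1` of `d^{[n]}`, where `h d^{[n]}` is the local discretization error, the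
residual of the exact values in the step from `t = t_{n-1}` to `t + h = t_n`. -/
def localDiscretizationError (P : RFDE E r) (y : C(ℝ, E)) (h t : ℝ) (i : Option (Fin s))
    (ω : Set.Icc (-(r : ℝ)) 0) : E :=
  h⁻¹ • ((M.exactValue (r := r) y h (t + h)).seg i ω
    - M.rhs P h t (M.exactValue y h t) (M.exactValue y h (t + h)) i ω)

/-- All points used by the step from `t` to `t + h`, namely the points of `[t - h, t + h]` and of
`[t - h, t + c_i h]`, lie in one piece of the subdivision `ξ`. -/
def IsRegularStep (k : ℕ) (ξ : ℕ → ℝ) (h t : ℝ) : Prop :=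
  ∃ i < k, ξ i ≤ t - h ∧ ∀ j, t + M.cExt j * h ≤ ξ (i + 1)

end

/-- The method has the property `Q` for all sufficiently smooth problems, all sufficiently small
step sizes `h = (T - t₀) / N` and all steps `n = 2, …, N` from `t_{n-1} = t₀ + (n - 1) h` to `t_n`
which do not cross a break point of the solution. The constant `C` handed to `Q` may depend on the
method and on the problem, but not on `N` and `n`. -/
def ForSmoothProblems
    (Q : ∀ (E : Type) [NormedAddCommGroup E] [NormedSpace ℝ E] (r : ℝ≥0),
      RFDE E r → C(ℝ, E) → ℝ → ℝ → ℝ → Prop) : Prop :=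
  ∃ l m : ℕ, ∀ (E : Type) [NormedAddCommGroup E] [NormedSpace ℝ E] [FiniteDimensional ℝ E]
    (r : ℝ≥0) (P : RFDE E r) (t₀ T : ℝ) (S : P.Solution t₀ T) (k : ℕ) (ξ : ℕ → ℝ),
    P.IsOfClass l → IsPiecewiseOfClass m k ξ S.y t₀ S.tEnd →
    ∃ C h₀ : ℝ, 0 < h₀ ∧ ∀ N : ℕ, 0 < N → ∀ h : ℝ, h = (T - t₀) / N → h < h₀ →
      ∀ n : ℕ, 2 ≤ n → n ≤ N → M.IsRegularStep k ξ h (t₀ + (n - 1) * h) →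
        Q E r P S.y C h (t₀ + (n - 1) * h)

/-- Uniform order of consistency `q`: `max_n ‖d^{[n], s+1}‖ = O(h^q)`. -/
def HasUniformOrderOfConsistency (q : ℕ) : Prop :=
  M.ForSmoothProblems fun _ _ _ _ P y C h t =>
    ∀ ω, ‖M.localDiscretizationError P y h t none ω‖ ≤ C * h ^ q

/-- Uniform order `q` of the error of one step: the step with exact input `Z^{[n-1]}` is defined
for small `h`, and its result `z^{[n]}` satisfies `max_n ‖Z^{[n], s+1} - z^{[n], s+1}‖ =
O(h^(q+1))`. -/
def HasUniformOneStepOrder (q : ℕ) : Prop :=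
  M.ForSmoothProblems fun E _ _ r P y C h t =>
    (∃ z' : StepData s r E, M.IsStep P h t (M.exactValue y h t) z') ∧
    ∀ z' : StepData s r E, M.IsStep P h t (M.exactValue y h t) z' →
      ∀ ω, ‖(M.exactValue (r := r) y h (t + h)).seg none ω - z'.seg none ω‖ ≤ C * h ^ (q + 1)

end TSRK

end

/-! Put `α = ω/h + c_i`. Taylor expansion of `y` and `y'` about `t = t_{n-1}` shows that, under
stage order one, the residual of the exact values in component `i` is `-h² Γ_{i2}(α) y''(t) - h³
Γ_{i3}(α) y'''(t) + O(h⁴)` (`norm_residual_add_le`). Either order-two hypothesis, applied to `y' =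
2t`, forces `Γ₂ = 0` on `[0,1]` (`Gamma_two_eq_zero`). Together with `Γ₃ = 0` the last residual is
`O(h⁴)`, which is consistency of order three.

For one step, the last component also carries `h ∑ b_j (f(Z_j) - f(z_j))`. The stage errors `e_j =
Z_j - z_j` are `-h² Γ_{j2} y''(t) + O(h³)` (`stageError_bound`), so this sum seems to be only
`O(h³)`. Linearizing `f` at the exact history costs `O(h⁴)` inside the sum. Stages with the same
abscissa share the point `t + c* h`, the history and hence the Fréchet derivative, which can be
pulled out of `∑ b_j e_j` over these stages. The hypothesis on `b_i Γ_{i2}` removes the `h²` part of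
that sum, so the whole term is `h · O(h³)` (`norm_oneStepError_le`). -/

/-! ### Taylor expansions with uniform remainders -/

section Taylor

variable {E : Type*} [NormedAddCommGroup E] [NormedSpace ℝ E]

/-- Integration of a bound `‖g'‖ ≤ B |x - t|^k` on an interval. -/
theorem norm_sub_le_of_norm_deriv_le_pow {I : Set ℝ} (hI : Convex ℝ I) {g g' : ℝ → E} {B t : ℝ}
    (hB : 0 ≤ B) (ht : t ∈ I) (k : ℕ) (hg : ∀ x ∈ I, HasDerivWithinAt g (g' x) I x)
    (hg' : ∀ x ∈ I, ‖g' x‖ ≤ B * |x - t| ^ k) {x : ℝ} (hx : x ∈ I) :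
    ‖g x - g t‖ ≤ B * |x - t| ^ (k + 1) := by
  have hsub : Set.uIcc t x ⊆ I := by
    rw [← segment_eq_uIcc]
    exact hI.segment_subset ht hx
  -- The derivative is bounded by its worst value on the segment from `t` to `x`. This gives up the
  -- factor `1/(k+1)` but keeps the same `B` through repeated integration.
  have key := (convex_uIcc t x).norm_image_sub_le_of_norm_hasDerivWithin_le
    (f := g) (f' := g') (C := B * |x - t| ^ k)
    (fun z hz => (hg z (hsub hz)).mono hsub)
    (fun z hz => (hg' z (hsub hz)).trans (by
      have : |z - t| ≤ |x - t| := Set.abs_sub_left_of_mem_uIcc hz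
      gcongr))
    Set.left_mem_uIcc Set.right_mem_uIcc
  rw [Real.norm_eq_abs] at key
  rw [pow_succ, ← mul_assoc]
  exact key

/-- Taylor expansions of order four of `y` and of order three of its derivative `y₁`, about every
point of `I` and uniformly on `I`. -/
structure TaylorBound (y y₁ y₂ y₃ : ℝ → E) (I : Set ℝ) (B : ℝ) : Prop where
  nonneg : 0 ≤ B
  hasDerivWithinAt : ∀ t ∈ I, HasDerivWithinAt y (y₁ t) I t
  norm_sub_le : ∀ t ∈ I, ∀ x ∈ I,
    ‖y x - (y t + (x - t) • y₁ t + ((x - t) ^ 2 / 2) • y₂ t + ((x - t) ^ 3 / 6) • y₃ t)‖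
      ≤ B * |x - t| ^ 4
  norm_deriv_sub_le : ∀ t ∈ I, ∀ x ∈ I,
    ‖y₁ x - (y₁ t + (x - t) • y₂ t + ((x - t) ^ 2 / 2) • y₃ t)‖ ≤ B * |x - t| ^ 3
  norm_two_le : ∀ t ∈ I, ‖y₂ t‖ ≤ B
  norm_three_le : ∀ t ∈ I, ‖y₃ t‖ ≤ B

theorem TaylorBound.mono {y y₁ y₂ y₃ : ℝ → E} {I : Set ℝ} {B B' : ℝ}
    (h : TaylorBound y y₁ y₂ y₃ I B) (hB : B ≤ B') : TaylorBound y y₁ y₂ y₃ I B' where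
  nonneg := h.nonneg.trans hB
  hasDerivWithinAt := h.hasDerivWithinAt
  norm_sub_le t ht x hx := (h.norm_sub_le t ht x hx).trans (by gcongr)
  norm_deriv_sub_le t ht x hx := (h.norm_deriv_sub_le t ht x hx).trans (by gcongr)
  norm_two_le t ht := (h.norm_two_le t ht).trans hB
  norm_three_le t ht := (h.norm_three_le t ht).trans hB

/-- The derivative of each Taylor remainder is the remainder of one order less for the next
derivative, so the bound on `y₄` is integrated four times. -/
theorem taylorBound_of_hasDerivWithinAt {y y₁ y₂ y₃ y₄ : ℝ → E} {I : Set ℝ} {B : ℝ}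
    (hI : Convex ℝ I) (hB : 0 ≤ B)
    (h₀ : ∀ t ∈ I, HasDerivWithinAt y (y₁ t) I t)
    (h₁ : ∀ t ∈ I, HasDerivWithinAt y₁ (y₂ t) I t)
    (h₂ : ∀ t ∈ I, HasDerivWithinAt y₂ (y₃ t) I t)
    (h₃ : ∀ t ∈ I, HasDerivWithinAt y₃ (y₄ t) I t)
    (b₂ : ∀ t ∈ I, ‖y₂ t‖ ≤ B) (b₃ : ∀ t ∈ I, ‖y₃ t‖ ≤ B) (b₄ : ∀ t ∈ I, ‖y₄ t‖ ≤ B) :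
    TaylorBound y y₁ y₂ y₃ I B := by
  have e₃ : ∀ t ∈ I, ∀ x ∈ I, ‖y₃ x - y₃ t‖ ≤ B * |x - t| ^ 1 := fun t ht x hx =>
    norm_sub_le_of_norm_deriv_le_pow hI hB ht 0 h₃ (by simpa using b₄) hx
  have e₂ : ∀ t ∈ I, ∀ x ∈ I, ‖y₂ x - (y₂ t + (x - t) • y₃ t)‖ ≤ B * |x - t| ^ 2 := by
    intro t ht x hx
    have := norm_sub_le_of_norm_deriv_le_pow hI hB ht 1 (g := fun x => y₂ x - (x - t) • y₃ t)
      (g' := fun x => y₃ x - (1 : ℝ) • y₃ t)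
      (fun x hx => (h₂ x hx).sub (((hasDerivWithinAt_id x I).sub_const t).smul_const _))
      (fun x hx => by simpa using e₃ t ht x hx) hx
    refine le_of_eq_of_le (congrArg norm ?_) this
    module
  have e₁ : ∀ t ∈ I, ∀ x ∈ I,
      ‖y₁ x - (y₁ t + (x - t) • y₂ t + ((x - t) ^ 2 / 2) • y₃ t)‖ ≤ B * |x - t| ^ 3 := by
    intro t ht x hx
    have := norm_sub_le_of_norm_deriv_le_pow hI hB ht 2
      (g := fun x => y₁ x - ((x - t) • y₂ t + ((x - t) ^ 2 / 2) • y₃ t))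
      (g' := fun x => y₂ x - (y₂ t + (x - t) • y₃ t))
      (fun x hx => by
        have d := (hasDerivWithinAt_id x I).sub_const t
        refine ((h₁ x hx).sub ((d.smul_const (y₂ t)).add
          (((d.pow 2).div_const 2).smul_const (y₃ t)))).congr_deriv ?_
        simp) (e₂ t ht) hx
    refine le_of_eq_of_le (congrArg norm ?_) this
    module
  refine ⟨hB, h₀, ?_, e₁, b₂, b₃⟩
  intro t ht x hx
  have := norm_sub_le_of_norm_deriv_le_pow hI hB ht 3
    (g := fun x => y x - ((x - t) • y₁ t + ((x - t) ^ 2 / 2) • y₂ t + ((x - t) ^ 3 / 6) • y₃ t))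
    (g' := fun x => y₁ x - (y₁ t + (x - t) • y₂ t + ((x - t) ^ 2 / 2) • y₃ t))
    (fun x hx => by
      have d := (hasDerivWithinAt_id x I).sub_const t
      refine ((h₀ x hx).sub (((d.smul_const (y₁ t)).add
        (((d.pow 2).div_const 2).smul_const (y₂ t))).add
        (((d.pow 3).div_const 6).smul_const (y₃ t)))).congr_deriv ?_
      simp only [id, Nat.cast_ofNat, mul_one, one_smul, Nat.add_one_sub_one, pow_one]
      module) (e₁ t ht) hx
  refine le_of_eq_of_le (congrArg norm ?_) this
  module

theorem ContDiffOn.exists_taylorBound {y : ℝ → E} {a b : ℝ} (hab : a < b)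
    (hy : ContDiffOn ℝ 4 y (Set.Icc a b)) :
    ∃ B, ∃ y₁ y₂ y₃ : ℝ → E, TaylorBound y y₁ y₂ y₃ (Set.Icc a b) B := by
  have hu : UniqueDiffOn ℝ (Set.Icc a b) := uniqueDiffOn_Icc hab
  have hbd : ∀ k : ℕ, k ≤ 4 →
      ∃ B, ∀ t ∈ Set.Icc a b, ‖iteratedDerivWithin k y (Set.Icc a b) t‖ ≤ B := fun k hk =>
    isCompact_Icc.exists_bound_of_continuousOn
      (hy.continuousOn_iteratedDerivWithin (by exact_mod_cast hk) hu)
  have hd : ∀ k : ℕ, k < 4 → ∀ t ∈ Set.Icc a b,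
      HasDerivWithinAt (iteratedDerivWithin k y (Set.Icc a b))
        (iteratedDerivWithin (k + 1) y (Set.Icc a b) t) (Set.Icc a b) t := by
    intro k hk t ht
    rw [iteratedDerivWithin_succ]
    exact (hy.differentiableOn_iteratedDerivWithin (by exact_mod_cast hk) hu
      t ht).hasDerivWithinAt
  obtain ⟨B₂, hB₂⟩ := hbd 2 (by norm_num)
  obtain ⟨B₃, hB₃⟩ := hbd 3 (by norm_num)
  obtain ⟨B₄, hB₄⟩ := hbd 4 le_rfl
  refine ⟨max 0 (max B₂ (max B₃ B₄)), _, _, _, taylorBound_of_hasDerivWithinAt (convex_Icc a b)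
    (le_max_left _ _) ?_ (hd 1 (by norm_num)) (hd 2 (by norm_num)) (hd 3 (by norm_num))
    ?_ ?_ ?_⟩
  · simpa only [iteratedDerivWithin_zero] using hd 0 (by norm_num)
  · exact fun t ht => (hB₂ t ht).trans (by simp)
  · exact fun t ht => (hB₃ t ht).trans (by simp)
  · exact fun t ht => (hB₄ t ht).trans (by simp)

/-- Splits a weighted sum of values of `y'` at `t + d_j h` into Taylor remainders and the moments of
the weights; these moments are the sums that make up `Γ_{i2}` and `Γ_{i3}`. -/
theorem sum_smul_eq_sum_smul_remainder {ι : Type*} (σ : Finset ι) (w d : ι → ℝ) (g : ι → E)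
    (h : ℝ) (y₁ y₂ y₃ : E) :
    ∑ j ∈ σ, w j • g j =
      ∑ j ∈ σ, w j • (g j - (y₁ + (d j * h) • y₂ + ((d j * h) ^ 2 / 2) • y₃))
      + (∑ j ∈ σ, w j) • y₁ + (h * ∑ j ∈ σ, w j * d j) • y₂
      + (h ^ 2 / 2 * ∑ j ∈ σ, w j * d j ^ 2) • y₃ := by
  simp only [Finset.mul_sum, Finset.sum_smul, ← Finset.sum_add_distrib]
  refine Finset.sum_congr rfl fun j _ => ?_
  module

theorem norm_sum_smul_le {ι : Type*} (σ : Finset ι) (w : ι → ℝ) (g : ι → E) (δ : ι → ℝ)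
    (hg : ∀ j ∈ σ, ‖g j‖ ≤ δ j) : ‖∑ j ∈ σ, w j • g j‖ ≤ ∑ j ∈ σ, |w j| * δ j := by
  refine (norm_sum_le _ _).trans (Finset.sum_le_sum fun j hj => ?_)
  rw [norm_smul, Real.norm_eq_abs]
  exact mul_le_mul_of_nonneg_left (hg j hj) (abs_nonneg _)

end Taylor

/-! ### Expansion of the residual in powers of `h` -/

namespace TSRK

variable {s : ℕ} (M : TSRK s)

theorem cExt_nonneg (i : Option (Fin s)) : 0 ≤ M.cExt i := by
  cases i with
  | none => exact zero_le_one
  | some i => exact M.c_nonneg i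

theorem StageOrderOne.eval_eq {M : TSRK s} (hM : M.StageOrderOne) (i : Option (Fin s)) {α : ℝ}
    (hα : α ∈ Set.Icc 0 (M.cExt i)) :
    (M.uExt i).eval α - 1 + ∑ j, (M.aTildeExt i j).eval α + ∑ j, (M.aExt i j).eval α = α := by
  cases i with
  | none => exact hM.1 α hα
  | some i => exact hM.2 i α hα

/-- The factor of `B h ^ 4` in the remainder of the expansion of the residual. -/
def remainderFactor (i : Option (Fin s)) (α : ℝ) : ℝ :=
  α ^ 4 + |1 - (M.uExt i).eval α| + ∑ j, |(M.aTildeExt i j).eval α| * |M.c j - 1| ^ 3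
    + ∑ j, |(M.aExt i j).eval α| * M.c j ^ 3

/-- A common bound on `[0, c_i]` for all coefficient functions that enter the estimates. -/
theorem exists_coefficient_bound : ∃ K, 0 ≤ K ∧ ∀ i, ∀ α ∈ Set.Icc 0 (M.cExt i),
    |M.Gamma i 2 α| ≤ K ∧ |M.Gamma i 3 α| ≤ K ∧ M.remainderFactor i α ≤ K ∧
      ∑ j, |(M.aExt i j).eval α| ≤ K := by
  have key : ∀ i, ∃ K, ∀ α ∈ Set.Icc 0 (M.cExt i),
      ‖|M.Gamma i 2 α| + |M.Gamma i 3 α| + |M.remainderFactor i α|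
        + ∑ j, |(M.aExt i j).eval α|‖ ≤ K := fun i =>
    isCompact_Icc.exists_bound_of_continuousOn (Continuous.continuousOn (by
      unfold Gamma remainderFactor
      fun_prop))
  choose K hK using key
  refine ⟨∑ i, |K i|, by positivity, fun i α hα => ?_⟩
  have h₁ := hK i α hα
  have h₂ : K i ≤ ∑ i, |K i| := (le_abs_self _).trans
    (Finset.single_le_sum (f := fun i => |K i|) (fun i _ => abs_nonneg _) (Finset.mem_univ i))
  have h₃ : 0 ≤ ∑ j, |(M.aExt i j).eval α| := by positivity
  have h₄ := abs_nonneg (M.Gamma i 2 α)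
  have h₅ := abs_nonneg (M.Gamma i 3 α)
  have h₆ := abs_nonneg (M.remainderFactor i α)
  have h₇ := le_abs_self (M.remainderFactor i α)
  rw [Real.norm_of_nonneg (by positivity)] at h₁
  refine ⟨?_, ?_, ?_, ?_⟩ <;> linarith

variable {E : Type} [NormedAddCommGroup E] [NormedSpace ℝ E] {r : ℝ≥0}

omit [NormedSpace ℝ E] in
theorem exactValue_seg_apply (y : C(ℝ, E)) (h t : ℝ) (i : Option (Fin s))
    (ω : Set.Icc (-(r : ℝ)) 0) :
    (M.exactValue (r := r) y h (t + h)).seg i ω = y (t + M.cExt i * h + ω) := by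
  change y (t + h + (M.cExt i - 1) * h + ω) = _
  congr 1
  ring

omit [NormedSpace ℝ E] in
theorem exactValue_seg_none_historyZero (y : C(ℝ, E)) (h t : ℝ) :
    (M.exactValue (r := r) y h t).seg none (historyZero r) = y t := by
  change y (t + ((1 : ℝ) - 1) * h + 0) = _
  congr 1
  ring

theorem f_exactValue_previous (P : RFDE E r) (y : C(ℝ, E)) (h t : ℝ) (j : Fin s) :
    P.f (t - h + M.c j * h) ((M.exactValue (r := r) y h t).seg (some j))
      = P.f (t - h + M.c j * h) (shift r y (t - h + M.c j * h)) := by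
  change P.f _ (shift r y (t + (M.c j - 1) * h)) = _
  congr 2
  ring

omit [NormedSpace ℝ E] in
theorem exactValue_seg_some (y : C(ℝ, E)) (h t : ℝ) (j : Fin s) :
    (M.exactValue (r := r) y h (t + h)).seg (some j) = shift r y (t + M.c j * h) := by
  change shift r y (t + h + (M.c j - 1) * h) = _
  congr 1
  ring

/-- To the left of `-c_i h` the method reproduces the exact values. -/
theorem rhs_exactValue_of_lt (P : RFDE E r) (y : C(ℝ, E)) (h t : ℝ) (hh : 0 < h)
    (z' : StepData s r E) (i : Option (Fin s)) (ω : Set.Icc (-(r : ℝ)) 0)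
    (hω : ¬ -(M.cExt i * h) ≤ (ω : ℝ)) :
    M.rhs P h t (M.exactValue y h t) z' i ω = (M.exactValue y h (t + h)).seg i ω := by
  have hc := mul_nonneg (M.cExt_nonneg i) hh.le
  rw [rhs, if_neg hω, exactValue_seg_apply,
    Set.projIcc_of_mem (by simp : -(r : ℝ) ≤ 0) ⟨by linarith [ω.2.1], by linarith⟩]
  change y (t + ((1 : ℝ) - 1) * h + (ω + M.cExt i * h)) = _
  congr 1
  ring

theorem mem_Icc_cExt {h : ℝ} (hh : 0 < h) (i : Option (Fin s)) (ω : Set.Icc (-(r : ℝ)) 0)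
    (hω : -(M.cExt i * h) ≤ (ω : ℝ)) : (ω : ℝ) / h + M.cExt i ∈ Set.Icc 0 (M.cExt i) := by
  have h₁ : -M.cExt i ≤ (ω : ℝ) / h := by
    rw [le_div_iff₀ hh]
    linarith
  have h₂ : (ω : ℝ) / h ≤ 0 := div_nonpos_of_nonpos_of_nonneg ω.2.2 hh.le
  exact ⟨by linarith, by linarith⟩

/-- Expansion of the residual of the exact values. -/
theorem norm_residual_add_le (hM : M.StageOrderOne) (P : RFDE E r) (y : C(ℝ, E))
    {y₁ y₂ y₃ : ℝ → E} {a b B : ℝ} (hy : TaylorBound y y₁ y₂ y₃ (Set.Icc a b) B)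
    (hf : ∀ x ∈ Set.Icc a b, P.f x (shift r y x) = y₁ x) {h t : ℝ} (hh : 0 < h)
    (ha : a ≤ t - h) (hb : ∀ j, t + M.cExt j * h ≤ b) (i : Option (Fin s))
    (ω : Set.Icc (-(r : ℝ)) 0) (hω : -(M.cExt i * h) ≤ (ω : ℝ)) :
    ‖(M.exactValue (r := r) y h (t + h)).seg i ω
        - M.rhs P h t (M.exactValue y h t) (M.exactValue y h (t + h)) i ω
        + (h ^ 2 * M.Gamma i 2 (ω / h + M.cExt i)) • y₂ t
        + (h ^ 3 * M.Gamma i 3 (ω / h + M.cExt i)) • y₃ t‖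
      ≤ M.remainderFactor i (ω / h + M.cExt i) * B * h ^ 4 := by
  have hα := M.mem_Icc_cExt hh i ω hω
  set α : ℝ := ω / h + M.cExt i with hα_def
  have hωα : t + M.cExt i * h + ω = t + α * h := by
    rw [hα_def]
    field_simp
    ring
  have hone := hM.eval_eq i hα
  have hαh : α * h ≤ M.cExt i * h := mul_le_mul_of_nonneg_right hα.2 hh.le
  have hαh' : 0 ≤ α * h := mul_nonneg hα.1 hh.le
  have mem_t : t ∈ Set.Icc a b :=
    ⟨by linarith, by linarith [hb i, mul_nonneg (M.cExt_nonneg i) hh.le]⟩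
  have mem_prev : t - h ∈ Set.Icc a b := ⟨ha, by linarith [mem_t.2]⟩
  have mem_α : t + α * h ∈ Set.Icc a b := ⟨by linarith, by linarith [hb i]⟩
  have mem_c : ∀ j, t + M.c j * h ∈ Set.Icc a b := fun j =>
    ⟨by linarith [mul_nonneg (M.c_nonneg j) hh.le], hb (some j)⟩
  have mem_c' : ∀ j, t - h + M.c j * h ∈ Set.Icc a b := fun j =>
    ⟨by linarith [mul_nonneg (M.c_nonneg j) hh.le], by linarith [(mem_c j).2]⟩
  rw [rhs, if_pos hω, exactValue_seg_apply, exactValue_seg_none_historyZero, hωα, ← hα_def]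
  -- The histories may reach back across break points, but they enter only through `f(x, y_x) =
  -- y'(x)` at points `x` of the smooth piece.
  simp only [f_exactValue_previous, exactValue_seg_some, hf _ (mem_c _), hf _ (mem_c' _)]
  change ‖y (t + α * h) - ((1 - (M.uExt i).eval α) • y (t - h) + _ + _ + _) + _ + _‖ ≤ _
  rw [sum_smul_eq_sum_smul_remainder _ (fun j => (M.aTildeExt i j).eval α) (fun j => M.c j - 1)
      (fun j => y₁ (t - h + M.c j * h)) h (y₁ t) (y₂ t) (y₃ t),
    sum_smul_eq_sum_smul_remainder _ (fun j => (M.aExt i j).eval α) M.c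
      (fun j => y₁ (t + M.c j * h)) h (y₁ t) (y₂ t) (y₃ t)]
  have r₀ := hy.norm_sub_le t mem_t _ mem_α
  have r₁ := hy.norm_sub_le t mem_t _ mem_prev
  have r₂ := norm_sum_smul_le Finset.univ (fun j => (M.aTildeExt i j).eval α)
    (fun j => y₁ (t - h + M.c j * h)
      - (y₁ t + ((M.c j - 1) * h) • y₂ t + (((M.c j - 1) * h) ^ 2 / 2) • y₃ t))
    (fun j => |M.c j - 1| ^ 3 * (B * h ^ 3)) (fun j _ => by
      have := hy.norm_deriv_sub_le t mem_t _ (mem_c' j)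
      rw [show t - h + M.c j * h - t = (M.c j - 1) * h by ring, abs_mul, abs_of_pos hh] at this
      exact this.trans (le_of_eq (by ring)))
  have r₃ := norm_sum_smul_le Finset.univ (fun j => (M.aExt i j).eval α)
    (fun j => y₁ (t + M.c j * h)
      - (y₁ t + (M.c j * h) • y₂ t + ((M.c j * h) ^ 2 / 2) • y₃ t))
    (fun j => M.c j ^ 3 * (B * h ^ 3)) (fun j _ => by
      have := hy.norm_deriv_sub_le t mem_t _ (mem_c j)
      rw [add_sub_cancel_left, abs_mul, abs_of_pos hh, abs_of_nonneg (M.c_nonneg j)] at this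
      exact this.trans (le_of_eq (by ring)))
  rw [add_sub_cancel_left, abs_of_nonneg hαh'] at r₀
  rw [show t - h - t = -h by ring, abs_neg, abs_of_pos hh] at r₁
  simp only [← mul_assoc, ← Finset.sum_mul] at r₂ r₃
  set ρ₀ := y (t + α * h) - (y t + (α * h) • y₁ t + ((α * h) ^ 2 / 2) • y₂ t
    + ((α * h) ^ 3 / 6) • y₃ t) with hρ₀
  set ρ₁ := y (t - h) - (y t + (-h) • y₁ t + ((-h) ^ 2 / 2) • y₂ t
    + ((-h) ^ 3 / 6) • y₃ t) with hρ₁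
  set ρ₂ := ∑ j, (M.aTildeExt i j).eval α • (y₁ (t - h + M.c j * h)
      - (y₁ t + ((M.c j - 1) * h) • y₂ t + (((M.c j - 1) * h) ^ 2 / 2) • y₃ t))
  set ρ₃ := ∑ j, (M.aExt i j).eval α • (y₁ (t + M.c j * h)
      - (y₁ t + (M.c j * h) • y₂ t + ((M.c j * h) ^ 2 / 2) • y₃ t))
  have hG₂ : M.Gamma i 2 α = (1 - (M.uExt i).eval α) / 2
      + ∑ j, (M.aTildeExt i j).eval α * (M.c j - 1)
      + ∑ j, (M.aExt i j).eval α * M.c j - α ^ 2 / 2 := by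
    simp [Gamma]
  have hG₃ : M.Gamma i 3 α = 1 / 2 * (-(1 - (M.uExt i).eval α) / 3
      + ∑ j, (M.aTildeExt i j).eval α * (M.c j - 1) ^ 2
      + ∑ j, (M.aExt i j).eval α * M.c j ^ 2 - α ^ 3 / 3) := by
    simp [Gamma]
    ring
  have hS : ∑ j, (M.aExt i j).eval α
      = α - (M.uExt i).eval α + 1 - ∑ j, (M.aTildeExt i j).eval α := by linarith
  have hid : y (t + α * h) - ((1 - (M.uExt i).eval α) • y (t - h) + (M.uExt i).eval α • y t
      + h • (ρ₂ + (∑ j, (M.aTildeExt i j).eval α) • y₁ t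
        + (h * ∑ j, (M.aTildeExt i j).eval α * (M.c j - 1)) • y₂ t
        + (h ^ 2 / 2 * ∑ j, (M.aTildeExt i j).eval α * (M.c j - 1) ^ 2) • y₃ t)
      + h • (ρ₃ + (∑ j, (M.aExt i j).eval α) • y₁ t
        + (h * ∑ j, (M.aExt i j).eval α * M.c j) • y₂ t
        + (h ^ 2 / 2 * ∑ j, (M.aExt i j).eval α * M.c j ^ 2) • y₃ t))
      + (h ^ 2 * M.Gamma i 2 α) • y₂ t + (h ^ 3 * M.Gamma i 3 α) • y₃ t
      = ρ₀ - (1 - (M.uExt i).eval α) • ρ₁ - h • ρ₂ - h • ρ₃ := by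
    -- Stage order one, in the form `hS`, cancels the terms in `y₁ t`; those in `y₂ t` and `y₃ t`
    -- are balanced by the added `Γ` terms.
    rw [hG₂, hG₃, hS, hρ₀, hρ₁]
    module
  rw [hid]
  have n₁ : ‖(1 - (M.uExt i).eval α) • ρ₁‖ ≤ |1 - (M.uExt i).eval α| * (B * h ^ 4) := by
    rw [norm_smul, Real.norm_eq_abs]
    gcongr
  have n₂ : ‖h • ρ₂‖ ≤ h * ((∑ j, |(M.aTildeExt i j).eval α| * |M.c j - 1| ^ 3) * B * h ^ 3) := by
    rw [norm_smul, Real.norm_of_nonneg hh.le]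
    gcongr
  have n₃ : ‖h • ρ₃‖ ≤ h * ((∑ j, |(M.aExt i j).eval α| * M.c j ^ 3) * B * h ^ 3) := by
    rw [norm_smul, Real.norm_of_nonneg hh.le]
    gcongr
  calc _ ≤ ‖ρ₀‖ + ‖(1 - (M.uExt i).eval α) • ρ₁‖ + ‖h • ρ₂‖ + ‖h • ρ₃‖ :=
        (norm_sub_le _ _).trans (add_le_add_left ((norm_sub_le _ _).trans
          (add_le_add_left (norm_sub_le _ _) _)) _)
    _ ≤ B * (α * h) ^ 4 + |1 - (M.uExt i).eval α| * (B * h ^ 4)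
        + h * ((∑ j, |(M.aTildeExt i j).eval α| * |M.c j - 1| ^ 3) * B * h ^ 3)
        + h * ((∑ j, |(M.aExt i j).eval α| * M.c j ^ 3) * B * h ^ 3) := by gcongr
    _ = _ := by
      rw [remainderFactor]
      ring

end TSRK

/-! ### Linearization of `f` along the solution -/

/-- Quadratic bound for the remainder of the linearization of a `C²` function on a ball. -/
theorem ContDiff.norm_sub_sub_fderiv_le {F G : Type*} [NormedAddCommGroup F] [NormedSpace ℝ F]
    [NormedAddCommGroup G] [NormedSpace ℝ G] {f : F → G} (hf : ContDiff ℝ 2 f) {φ ψ : F}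
    {δ A : ℝ} (hA : 0 ≤ A) (hball : ∀ x ∈ Metric.ball φ δ, ‖iteratedFDeriv ℝ 2 f x‖ ≤ A)
    (hψ : ‖φ - ψ‖ < δ) : ‖f φ - f ψ - fderiv ℝ f φ (φ - ψ)‖ ≤ A * ‖φ - ψ‖ ^ 2 := by
  have hdiff : Differentiable ℝ (fderiv ℝ f) :=
    (hf.fderiv_right (m := 1) (by norm_num)).differentiable one_ne_zero
  have hlip : ∀ x ∈ Metric.ball φ δ, ‖fderiv ℝ f x - fderiv ℝ f φ‖ ≤ A * ‖x - φ‖ := fun x hx =>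
    (convex_ball φ δ).norm_image_sub_le_of_norm_fderiv_le (𝕜 := ℝ) (fun z _ => hdiff z)
      (fun z hz => by
        rw [← norm_iteratedFDeriv_one, norm_iteratedFDeriv_fderiv]
        exact hball z hz)
      (Metric.mem_ball_self ((norm_nonneg _).trans_lt hψ)) hx
  rw [norm_sub_rev] at hψ
  -- Mean value inequality for `f - Df(φ)`: by `hlip` its derivative is at most `A ‖ψ - φ‖` on this
  -- closed ball, which lies in the open ball of radius `δ`.
  have key := (convex_closedBall φ ‖ψ - φ‖).norm_image_sub_le_of_norm_fderiv_le'
    (f := f) (𝕜 := ℝ) (φ := fderiv ℝ f φ) (C := A * ‖ψ - φ‖)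
    (fun x _ => (hf.differentiable two_ne_zero) x)
    (fun x hx => by
      rw [mem_closedBall_iff_norm] at hx
      refine (hlip x (mem_ball_iff_norm.2 (hx.trans_lt hψ))).trans ?_
      gcongr)
    (x := φ) (y := ψ) (Metric.mem_closedBall_self (norm_nonneg _)) (by simp [dist_eq_norm])
  have hneg : f φ - f ψ - fderiv ℝ f φ (φ - ψ) = -(f ψ - f φ - fderiv ℝ f φ (ψ - φ)) := by
    rw [← neg_sub ψ φ, map_neg]
    abel
  rw [hneg, norm_neg, norm_sub_rev φ ψ, sq, ← mul_assoc]
  exact key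

theorem continuous_shift {E : Type} [NormedAddCommGroup E] (r : ℝ≥0) (y : C(ℝ, E)) :
    Continuous (shift r y) :=
  (ContinuousMap.curry ⟨fun p : ℝ × Set.Icc (-(r : ℝ)) 0 => y (p.1 + (p.2 : ℝ)),
    by fun_prop⟩).continuous

namespace RFDE

variable {E : Type} [NormedAddCommGroup E] [NormedSpace ℝ E] {r : ℝ≥0}

theorem IsOfClass.of_le {P : RFDE E r} {l l' : ℕ} (hP : P.IsOfClass l') (hl : l ≤ l') :
    P.IsOfClass l :=
  ⟨fun t => (hP.1 t).of_le (by exact_mod_cast hl), fun k hk => hP.2 k (hk.trans hl)⟩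

theorem exists_lipschitz (P : RFDE E r) :
    ∃ L, 0 ≤ L ∧ (∀ t φ, ‖fderiv ℝ (P.f t) φ‖ ≤ L) ∧
      ∀ t φ ψ, ‖P.f t φ - P.f t ψ‖ ≤ L * ‖φ - ψ‖ := by
  obtain ⟨L, hL⟩ := P.bounded_deriv
  refine ⟨L, (norm_nonneg (fderiv ℝ (P.f 0) 0)).trans (hL 0 0), hL, fun t φ ψ => ?_⟩
  exact convex_univ.norm_image_sub_le_of_norm_fderiv_le
    (fun x _ => ((P.contDiff_one t).differentiable one_ne_zero) x) (fun x _ => hL t x)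
    (Set.mem_univ ψ) (Set.mem_univ φ)

/-- Quadratic remainder of the linearization of `f` along a compact arc of `t ↦ (t, y_t)`. -/
theorem IsOfClass.exists_linearization_bound {P : RFDE E r} (hP : P.IsOfClass 2)
    (y : C(ℝ, E)) (a b : ℝ) :
    ∃ A δ, 0 ≤ A ∧ 0 < δ ∧ ∀ t ∈ Set.Icc a b, ∀ ψ, ‖shift r y t - ψ‖ < δ →
      ‖P.f t (shift r y t) - P.f t ψ - fderiv ℝ (P.f t) (shift r y t) (shift r y t - ψ)‖
        ≤ A * ‖shift r y t - ψ‖ ^ 2 := by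
  have hcont : Continuous fun p : ℝ × History r E => ‖iteratedFDeriv ℝ 2 (P.f p.1) p.2‖ :=
    (hP.2 2 le_rfl).norm
  have hK : IsCompact ((fun t => (t, shift r y t)) '' Set.Icc a b) :=
    isCompact_Icc.image (continuous_id.prodMk (continuous_shift r y))
  obtain ⟨A, hA⟩ := hK.exists_bound_of_continuousOn hcont.continuousOn
  have hsub : (fun t => (t, shift r y t)) '' Set.Icc a b ⊆
      {p : ℝ × History r E | ‖iteratedFDeriv ℝ 2 (P.f p.1) p.2‖ < |A| + 1} := by
    intro p hp
    have := hA p hp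
    rw [norm_norm] at this
    exact lt_of_le_of_lt (this.trans (le_abs_self A)) (lt_add_one _)
  -- Balls of histories need not be compact, so the second derivative is bounded near the compact
  -- arc only: the open set where it is below `|A| + 1` contains a uniform neighbourhood.
  obtain ⟨δ, hδ, hδK⟩ := hK.exists_thickening_subset_open (isOpen_lt hcont continuous_const) hsub
  refine ⟨|A| + 1, δ, by positivity, hδ, fun t ht ψ hψ => ?_⟩
  refine ContDiff.norm_sub_sub_fderiv_le (hP.1 t) (by positivity) (fun x hx => ?_) hψ
  refine le_of_lt (hδK (a := (t, x)) ?_)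
  refine Metric.mem_thickening_iff.2 ⟨(t, shift r y t), ⟨t, ht, rfl⟩, ?_⟩
  rw [Prod.dist_eq, dist_self]
  exact max_lt hδ hx

end RFDE

/-! ### Solutions of piecewise class: constants common to all pieces -/

namespace IsPiecewiseOfClass

variable {E : Type} [NormedAddCommGroup E] [NormedSpace ℝ E] {m k : ℕ} {ξ : ℕ → ℝ} {y : ℝ → E}
  {a b : ℝ}

theorem of_le {m' : ℕ} (hy : IsPiecewiseOfClass m' k ξ y a b) (hm : m ≤ m') :
    IsPiecewiseOfClass m k ξ y a b :=
  ⟨hy.1, hy.2.1, fun i hi => ⟨(hy.2.2 i hi).1, (hy.2.2 i hi).2.of_le (by exact_mod_cast hm)⟩⟩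

theorem Icc_subset (hy : IsPiecewiseOfClass m k ξ y a b) {i : ℕ} (hi : i < k) :
    Set.Icc (ξ i) (ξ (i + 1)) ⊆ Set.Icc a b := by
  have hmono : ∀ j, ∀ i ≤ j, j ≤ k → ξ i ≤ ξ j := by
    intro j
    induction j with
    | zero =>
      intro i hi _
      rw [Nat.le_zero.1 hi]
    | succ j ih =>
      intro i hi hj
      rcases hi.lt_or_eq with h | h
      · exact (ih i (Nat.lt_succ_iff.1 h) (by omega)).trans (hy.2.2 j hj).1.le
      · rw [h]
  refine Set.Icc_subset_Icc ?_ ?_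
  · rw [← hy.1]
    exact hmono i 0 (Nat.zero_le _) hi.le
  · rw [← hy.2.1]
    exact hmono k (i + 1) hi le_rfl

theorem exists_taylorBound (hy : IsPiecewiseOfClass 4 k ξ y a b) :
    ∃ B, 0 ≤ B ∧ ∀ i < k, ∃ y₁ y₂ y₃, TaylorBound y y₁ y₂ y₃ (Set.Icc (ξ i) (ξ (i + 1))) B := by
  have key : ∀ i : Fin k, ∃ B, ∃ y₁ y₂ y₃,
      TaylorBound y y₁ y₂ y₃ (Set.Icc (ξ i) (ξ (i + 1))) B := fun i =>
    ContDiffOn.exists_taylorBound (hy.2.2 i i.2).1 (hy.2.2 i i.2).2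
  choose B y₁ y₂ y₃ hB using key
  refine ⟨∑ i, |B i|, by positivity, fun i hi => ⟨_, _, _, (hB ⟨i, hi⟩).mono ?_⟩⟩
  exact (le_abs_self _).trans (Finset.single_le_sum (f := fun i => |B i|)
    (fun i _ => abs_nonneg _) (Finset.mem_univ (⟨i, hi⟩ : Fin k)))

end IsPiecewiseOfClass

/-- On an interval of existence the derivative of the solution is the right-hand side. -/
theorem RFDE.Solution.f_shift_eq {E : Type} [NormedAddCommGroup E] [NormedSpace ℝ E] {r : ℝ≥0}
    {P : RFDE E r} {t₀ T : ℝ} (S : P.Solution t₀ T) {a b B : ℝ} {y₁ y₂ y₃ : ℝ → E} (hab : a < b)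
    (hsub : Set.Icc a b ⊆ Set.Icc t₀ S.tEnd) (hy : TaylorBound S.y y₁ y₂ y₃ (Set.Icc a b) B) :
    ∀ x ∈ Set.Icc a b, P.f x (shift r S.y x) = y₁ x := fun x hx =>
  (uniqueDiffOn_Icc hab x hx).eq_deriv _ ((S.isSolution x (hsub hx)).mono hsub)
    (hy.hasDerivWithinAt x hx)

/-! ### Stage errors of a step from exact values -/

namespace TSRK

variable {s : ℕ} (M : TSRK s) {E : Type} [NormedAddCommGroup E] [NormedSpace ℝ E] {r : ℝ≥0}

theorem rhs_sub_rhs (P : RFDE E r) (h t : ℝ) (z z' z'' : StepData s r E) (i : Option (Fin s))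
    (ω : Set.Icc (-(r : ℝ)) 0) (hω : -(M.cExt i * h) ≤ (ω : ℝ)) :
    M.rhs P h t z z' i ω - M.rhs P h t z z'' i ω =
      h • ∑ j, (M.aExt i j).eval (ω / h + M.cExt i) •
        (P.f (t + M.c j * h) (z'.seg (some j)) - P.f (t + M.c j * h) (z''.seg (some j))) := by
  rw [rhs, rhs, if_pos hω, if_pos hω, add_sub_add_left_eq_sub, ← smul_sub,
    ← Finset.sum_sub_distrib]
  simp only [smul_sub]

/-- The error `Z^{[n], i} - z^{[n], i}` of a step from exact values. -/
theorem stepError_apply (P : RFDE E r) (y : C(ℝ, E)) {h t : ℝ} {z' : StepData s r E}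
    (hz : M.IsStep P h t (M.exactValue y h t) z') (i : Option (Fin s))
    (ω : Set.Icc (-(r : ℝ)) 0) (hω : -(M.cExt i * h) ≤ (ω : ℝ)) :
    (M.exactValue (r := r) y h (t + h)).seg i ω - z'.seg i ω =
      ((M.exactValue (r := r) y h (t + h)).seg i ω
        - M.rhs P h t (M.exactValue y h t) (M.exactValue y h (t + h)) i ω)
      + h • ∑ j, (M.aExt i j).eval (ω / h + M.cExt i) •
        (P.f (t + M.c j * h) (shift r y (t + M.c j * h))
          - P.f (t + M.c j * h) (z'.seg (some j))) := by
  have := M.rhs_sub_rhs P h t (M.exactValue y h t) (M.exactValue y h (t + h)) z' i ω hω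
  simp only [exactValue_seg_some] at this
  rw [hz.1, ← this]
  abel

/-- Complements the cancellation hypothesis, which covers only `β ∈ [0, c*]`, that is, `ω ≥ -c* h`.
-/
theorem stepError_apply_of_lt (P : RFDE E r) (y : C(ℝ, E)) {h t : ℝ} (hh : 0 < h)
    {z' : StepData s r E} (hz : M.IsStep P h t (M.exactValue y h t) z') (i : Option (Fin s))
    (ω : Set.Icc (-(r : ℝ)) 0) (hω : ¬ -(M.cExt i * h) ≤ (ω : ℝ)) :
    (M.exactValue (r := r) y h (t + h)).seg i ω - z'.seg i ω = 0 := by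
  rw [hz.1, M.rhs_exactValue_of_lt P y h t hh z' i ω hω, sub_self]

theorem norm_sum_aExt_smul_le {K : ℝ}
    (hK : ∀ i, ∀ α ∈ Set.Icc 0 (M.cExt i), ∑ j, |(M.aExt i j).eval α| ≤ K)
    (i : Option (Fin s)) {α : ℝ} (hα : α ∈ Set.Icc 0 (M.cExt i)) {g : Fin s → E} {D : ℝ}
    (hD : 0 ≤ D) (hg : ∀ j, ‖g j‖ ≤ D) : ‖∑ j, (M.aExt i j).eval α • g j‖ ≤ K * D := by
  refine (norm_sum_smul_le Finset.univ _ g (fun _ => D) (fun j _ => hg j)).trans ?_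
  rw [← Finset.sum_mul]
  exact mul_le_mul_of_nonneg_right (hK i α hα) hD

section Estimates

variable {P : RFDE E r} {y : C(ℝ, E)} {y₁ y₂ y₃ : ℝ → E} {a b B K L h t : ℝ}
  {z' : StepData s r E}

/-- Stage errors are `-h² Γ_{i2} y''(t) + O(h³)`, and `O(h²)` in norm. -/
theorem stageError_bound (hM : M.StageOrderOne)
    (hK₀ : 0 ≤ K) (hK : ∀ i, ∀ α ∈ Set.Icc 0 (M.cExt i),
      |M.Gamma i 2 α| ≤ K ∧ |M.Gamma i 3 α| ≤ K ∧ M.remainderFactor i α ≤ K ∧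
      ∑ j, |(M.aExt i j).eval α| ≤ K)
    (hL₀ : 0 ≤ L) (hL : ∀ t φ ψ, ‖P.f t φ - P.f t ψ‖ ≤ L * ‖φ - ψ‖)
    (hy : TaylorBound y y₁ y₂ y₃ (Set.Icc a b) B)
    (hf : ∀ x ∈ Set.Icc a b, P.f x (shift r y x) = y₁ x) (hh : 0 < h) (hh₁ : h ≤ 1)
    (hKL : h * (K * L) ≤ 1 / 2) (ha : a ≤ t - h) (hb : ∀ j, t + M.cExt j * h ≤ b)
    (hz : M.IsStep P h t (M.exactValue y h t) z') :
    (∀ j, ‖shift r y (t + M.c j * h) - z'.seg (some j)‖ ≤ 6 * K * B * h ^ 2) ∧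
    ∀ (j : Fin s) (ω : Set.Icc (-(r : ℝ)) 0), -(M.c j * h) ≤ (ω : ℝ) →
      ‖(shift r y (t + M.c j * h) - z'.seg (some j)) ω
        + (h ^ 2 * M.Gamma (some j) 2 (ω / h + M.c j)) • y₂ t‖
        ≤ (2 * K * B + 6 * K ^ 2 * L * B) * h ^ 3 := by
  have hB := hy.nonneg
  have mem_t : t ∈ Set.Icc a b := by
    refine ⟨by linarith, ?_⟩
    linarith [hb none, mul_nonneg (M.cExt_nonneg none) hh.le]
  have hK₄ : ∀ i, ∀ α ∈ Set.Icc 0 (M.cExt i), ∑ j, |(M.aExt i j).eval α| ≤ K :=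
    fun i α hα => (hK i α hα).2.2.2
  have h₄₃ : h ^ 4 ≤ h ^ 3 := pow_le_pow_of_le_one hh.le hh₁ (by norm_num)
  have h₃₂ : h ^ 3 ≤ h ^ 2 := pow_le_pow_of_le_one hh.le hh₁ (by norm_num)
  -- The stages are coupled through `f`, so they are estimated together, in the maximum norm of the
  -- tuple.
  set e : Fin s → History r E := fun j => shift r y (t + M.c j * h) - z'.seg (some j) with he
  have he_apply : ∀ j ω, e j ω =
      (M.exactValue (r := r) y h (t + h)).seg (some j) ω - z'.seg (some j) ω := by
    intro j ω
    rw [exactValue_seg_some]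
    rfl
  have hdiff : ∀ j, ‖P.f (t + M.c j * h) (shift r y (t + M.c j * h))
      - P.f (t + M.c j * h) (z'.seg (some j))‖ ≤ L * ‖e‖ := fun j =>
    (hL _ _ _).trans (mul_le_mul_of_nonneg_left (norm_le_pi_norm e j) hL₀)
  have hexp : ∀ (j : Fin s) (ω : Set.Icc (-(r : ℝ)) 0), -(M.c j * h) ≤ (ω : ℝ) →
      ‖e j ω + (h ^ 2 * M.Gamma (some j) 2 (ω / h + M.c j)) • y₂ t‖
        ≤ 2 * K * B * h ^ 3 + h * (K * (L * ‖e‖)) := by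
    intro j ω hω
    have hα := M.mem_Icc_cExt hh (some j) ω hω
    obtain ⟨-, hG₃, hR, -⟩ := hK (some j) _ hα
    have r₁ := M.norm_residual_add_le hM P y hy hf hh ha hb (some j) ω hω
    have r₂ := M.norm_sum_aExt_smul_le hK₄ (some j) hα (by positivity) hdiff
    have r₃ : ‖(h ^ 3 * M.Gamma (some j) 3 (ω / h + M.cExt (some j))) • y₃ t‖
        ≤ h ^ 3 * K * B := by
      rw [norm_smul, Real.norm_eq_abs, abs_mul, abs_of_pos (by positivity : 0 < h ^ 3)]
      have := hy.norm_three_le t mem_t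
      gcongr
    have r₄ : M.remainderFactor (some j) (ω / h + M.cExt (some j)) * B * h ^ 4
        ≤ K * B * h ^ 3 := by gcongr
    rw [he_apply, M.stepError_apply P y hz (some j) ω hω]
    set ρ := (M.exactValue (r := r) y h (t + h)).seg (some j) ω
        - M.rhs P h t (M.exactValue y h t) (M.exactValue y h (t + h)) (some j) ω
    set S := ∑ i, (M.aExt (some j) i).eval (ω / h + M.cExt (some j)) •
        (P.f (t + M.c i * h) (shift r y (t + M.c i * h))
          - P.f (t + M.c i * h) (z'.seg (some i)))
    set g₃ := (h ^ 3 * M.Gamma (some j) 3 (ω / h + M.cExt (some j))) • y₃ t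
    change ‖ρ + h • S + (h ^ 2 * M.Gamma (some j) 2 (ω / h + M.cExt (some j))) • y₂ t‖ ≤ _
    set g₂ := (h ^ 2 * M.Gamma (some j) 2 (ω / h + M.cExt (some j))) • y₂ t
    have r₅ : ‖h • S‖ ≤ h * (K * (L * ‖e‖)) := by
      rw [norm_smul, Real.norm_of_nonneg hh.le]
      gcongr
    calc ‖ρ + h • S + g₂‖ = ‖(ρ + g₂ + g₃) + h • S - g₃‖ := by
          congr 1
          abel
      _ ≤ ‖ρ + g₂ + g₃‖ + ‖h • S‖ + ‖g₃‖ :=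
          (norm_sub_le _ _).trans (add_le_add_left (norm_add_le _ _) _)
      _ ≤ _ := by linarith
  -- The coefficient 3 collects the remainder, the `Γ_{i3}` term and the `Γ_{i2}` term. Since `h K L
  -- ≤ 1/2`, the term with `‖e‖` is then absorbed on the left, which doubles 3 to 6.
  have hbound : ∀ j, ‖e j‖ ≤ 3 * K * B * h ^ 2 + h * (K * (L * ‖e‖)) := by
    intro j
    refine (ContinuousMap.norm_le _ (by positivity)).2 fun ω => ?_
    by_cases hω : -(M.c j * h) ≤ (ω : ℝ)
    · have r₁ := hexp j ω hω
      have r₂ : ‖(h ^ 2 * M.Gamma (some j) 2 (ω / h + M.c j)) • y₂ t‖ ≤ h ^ 2 * K * B := by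
        rw [norm_smul, Real.norm_eq_abs, abs_mul, abs_of_pos (by positivity : 0 < h ^ 2)]
        have := hy.norm_two_le t mem_t
        have := (hK (some j) _ (M.mem_Icc_cExt hh (some j) ω hω)).1
        gcongr
        exact this
      have r₃ : 2 * K * B * h ^ 3 ≤ 2 * K * B * h ^ 2 := by gcongr
      have r₄ := norm_sub_le (e j ω + (h ^ 2 * M.Gamma (some j) 2 (ω / h + M.c j)) • y₂ t)
        ((h ^ 2 * M.Gamma (some j) 2 (ω / h + M.c j)) • y₂ t)
      rw [add_sub_cancel_right] at r₄
      linarith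
    · rw [he_apply, M.stepError_apply_of_lt P y hh hz (some j) ω hω, norm_zero]
      positivity
  have hnorm : ‖e‖ ≤ 6 * K * B * h ^ 2 := by
    have := (pi_norm_le_iff_of_nonneg (by positivity)).2 hbound
    have h₁ : h * (K * (L * ‖e‖)) ≤ 1 / 2 * ‖e‖ := by
      have := mul_le_mul_of_nonneg_right hKL (norm_nonneg e)
      linarith
    linarith
  refine ⟨fun j => (norm_le_pi_norm e j).trans hnorm, fun j ω hω => (hexp j ω hω).trans ?_⟩
  calc _ ≤ 2 * K * B * h ^ 3 + h * (K * (L * (6 * K * B * h ^ 2))) := by gcongr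
    _ = _ := by ring

end Estimates

end TSRK

/-! ### Cancellation in the last component -/

namespace TSRK

variable {s : ℕ} (M : TSRK s)

section OneStep

variable {E : Type} [NormedAddCommGroup E] [NormedSpace ℝ E] {r : ℝ≥0}
  {P : RFDE E r} {y : C(ℝ, E)} {y₁ y₂ y₃ : ℝ → E} {a b B K L h t : ℝ} {z' : StepData s r E}

/-- The weighted stage errors of the stages with a common abscissa cancel up to `O(h³)`. -/
theorem norm_sum_fiber_stageError_le {D α cstar : ℝ} {w : E} {e : Fin s → History r E}
    (hb : ∀ β ∈ Set.Icc 0 cstar,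
      ∑ i with M.c i = cstar, (M.b i).eval α * M.Gamma (some i) 2 β = 0)
    (hD : 0 ≤ D) (hK₀ : 0 ≤ K) (hK : ∑ j, |(M.b j).eval α| ≤ K) (hh : 0 < h)
    (he : ∀ (j : Fin s) (ω : Set.Icc (-(r : ℝ)) 0), -(M.c j * h) ≤ (ω : ℝ) →
      ‖e j ω + (h ^ 2 * M.Gamma (some j) 2 (ω / h + M.c j)) • w‖ ≤ D)
    (he₀ : ∀ (j : Fin s) (ω : Set.Icc (-(r : ℝ)) 0), ¬ -(M.c j * h) ≤ (ω : ℝ) → e j ω = 0) :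
    ‖∑ j with M.c j = cstar, (M.b j).eval α • e j‖ ≤ K * D := by
  refine (ContinuousMap.norm_le _ (by positivity)).2 fun ω => ?_
  rw [ContinuousMap.sum_apply]
  simp only [ContinuousMap.smul_apply]
  by_cases hω : -(cstar * h) ≤ (ω : ℝ)
  · have hβ : (ω : ℝ) / h + cstar ∈ Set.Icc 0 cstar := by
      have h₁ : -cstar ≤ (ω : ℝ) / h := by
        rw [le_div_iff₀ hh]
        linarith
      have h₂ : (ω : ℝ) / h ≤ 0 := div_nonpos_of_nonpos_of_nonneg ω.2.2 hh.le
      exact ⟨by linarith, by linarith⟩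
    -- With a common abscissa, all `Γ_{j2}` are taken at the same `β = ω/h + c*`, so adding the
    -- leading terms changes nothing.
    have hsum : ∑ j with M.c j = cstar, (M.b j).eval α • e j ω
        = ∑ j with M.c j = cstar, (M.b j).eval α •
          (e j ω + (h ^ 2 * M.Gamma (some j) 2 (ω / h + cstar)) • w) := by
      have hzero : (∑ j with M.c j = cstar, (M.b j).eval α *
          (h ^ 2 * M.Gamma (some j) 2 (ω / h + cstar))) = 0 := by
        simp only [mul_left_comm _ (h ^ 2)]
        rw [← Finset.mul_sum, hb _ hβ, mul_zero]
      simp only [smul_add, Finset.sum_add_distrib, smul_smul, ← Finset.sum_smul, hzero,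
        zero_smul, add_zero]
    rw [hsum]
    refine (norm_sum_smul_le _ _ _ (fun _ => D) fun j hj => ?_).trans ?_
    · obtain rfl := (Finset.mem_filter.1 hj).2
      exact he j ω hω
    · rw [← Finset.sum_mul]
      refine mul_le_mul_of_nonneg_right (le_trans ?_ hK) hD
      exact Finset.sum_le_sum_of_subset_of_nonneg (Finset.filter_subset _ _)
        fun _ _ _ => abs_nonneg _
  · rw [Finset.sum_eq_zero, norm_zero]
    · positivity
    · intro j hj
      obtain rfl := (Finset.mem_filter.1 hj).2
      rw [he₀ j ω hω, smul_zero]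

/-- The error of one step is `O(h⁴)` if `Γ₂ = Γ₃ = 0`. -/
theorem norm_oneStepError_le {A δ : ℝ} (hM : M.StageOrderOne)
    (hΓ₂ : ∀ α ∈ Set.Icc (0 : ℝ) 1, M.Gamma none 2 α = 0)
    (hΓ₃ : ∀ α ∈ Set.Icc (0 : ℝ) 1, M.Gamma none 3 α = 0)
    (hcancel : ∀ cstar ∈ Set.range M.c, ∀ α ∈ Set.Icc (0 : ℝ) 1, ∀ β ∈ Set.Icc 0 cstar,
      ∑ i with M.c i = cstar, (M.b i).eval α * M.Gamma (some i) 2 β = 0)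
    (hK₀ : 0 ≤ K) (hK : ∀ i, ∀ α ∈ Set.Icc 0 (M.cExt i),
      |M.Gamma i 2 α| ≤ K ∧ |M.Gamma i 3 α| ≤ K ∧ M.remainderFactor i α ≤ K ∧
      ∑ j, |(M.aExt i j).eval α| ≤ K)
    (hL₀ : 0 ≤ L) (hL' : ∀ t φ, ‖fderiv ℝ (P.f t) φ‖ ≤ L)
    (hL : ∀ t φ ψ, ‖P.f t φ - P.f t ψ‖ ≤ L * ‖φ - ψ‖)
    (hA : 0 ≤ A) (hlin : ∀ x ∈ Set.Icc a b, ∀ ψ, ‖shift r y x - ψ‖ < δ →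
      ‖P.f x (shift r y x) - P.f x ψ - fderiv ℝ (P.f x) (shift r y x) (shift r y x - ψ)‖
        ≤ A * ‖shift r y x - ψ‖ ^ 2)
    (hy : TaylorBound y y₁ y₂ y₃ (Set.Icc a b) B)
    (hf : ∀ x ∈ Set.Icc a b, P.f x (shift r y x) = y₁ x) (hh : 0 < h) (hh₁ : h ≤ 1)
    (hKL : h * (K * L) ≤ 1 / 2) (hδ : h * (6 * K * B) < δ)
    (ha : a ≤ t - h) (hb : ∀ j, t + M.cExt j * h ≤ b)
    (hz : M.IsStep P h t (M.exactValue y h t) z') (ω : Set.Icc (-(r : ℝ)) 0) :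
    ‖(M.exactValue (r := r) y h (t + h)).seg none ω - z'.seg none ω‖ ≤
      (K * B + s * (L * (K * (2 * K * B + 6 * K ^ 2 * L * B))) + K * (A * (6 * K * B) ^ 2))
        * h ^ 4 := by
  have hB := hy.nonneg
  by_cases hω : -(M.cExt none * h) ≤ (ω : ℝ)
  swap
  · rw [M.stepError_apply_of_lt P y hh hz none ω hω, norm_zero]
    positivity
  obtain ⟨he, hexp⟩ := M.stageError_bound hM hK₀ hK hL₀ hL hy hf hh hh₁ hKL ha hb hz
  have he₀ : ∀ (j : Fin s) (ω : Set.Icc (-(r : ℝ)) 0), ¬ -(M.c j * h) ≤ (ω : ℝ) →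
      (shift r y (t + M.c j * h) - z'.seg (some j)) ω = 0 := by
    intro j ω hω
    have := M.stepError_apply_of_lt P y hh hz (some j) ω hω
    rwa [exactValue_seg_some] at this
  have hα := M.mem_Icc_cExt hh none ω hω
  have r₁ := M.norm_residual_add_le hM P y hy hf hh ha hb none ω hω
  rw [M.stepError_apply P y hz none ω hω]
  set α : ℝ := ω / h + M.cExt none
  rw [hΓ₂ α hα, hΓ₃ α hα, mul_zero, mul_zero, zero_smul, zero_smul, add_zero, add_zero] at r₁
  obtain ⟨-, -, hR, hsumK⟩ := hK none α hα
  change ∑ j, |(M.b j).eval α| ≤ K at hsumK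
  set e : Fin s → History r E := fun j => shift r y (t + M.c j * h) - z'.seg (some j)
  set D : ℝ := (2 * K * B + 6 * K ^ 2 * L * B) * h ^ 3 with hD
  have hD₀ : 0 ≤ D := by positivity
  let F : ℝ → History r E →L[ℝ] E := fun x =>
    fderiv ℝ (P.f (t + x * h)) (shift r y (t + x * h))
  have hmem : ∀ j, t + M.c j * h ∈ Set.Icc a b := fun j =>
    ⟨by linarith [mul_nonneg (M.c_nonneg j) hh.le], hb (some j)⟩
  have hnl : ∀ j, ‖P.f (t + M.c j * h) (shift r y (t + M.c j * h))
      - P.f (t + M.c j * h) (z'.seg (some j)) - F (M.c j) (e j)‖ ≤ A * (6 * K * B * h ^ 2) ^ 2 := by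
    intro j
    refine (hlin _ (hmem j) _ ((he j).trans_lt ?_)).trans ?_
    · refine lt_of_le_of_lt ?_ hδ
      have : h ^ 2 ≤ h := by nlinarith
      have := mul_le_mul_of_nonneg_left this (by positivity : 0 ≤ 6 * K * B)
      linarith
    · have := he j
      gcongr
  have hfib : ‖∑ j, (M.b j).eval α • F (M.c j) (e j)‖ ≤ s * (L * (K * D)) := by
    -- `F` depends on the stage only through its abscissa, so it factors out of each group; there
    -- are at most `s` groups.
    have hgroup : ∑ j, (M.b j).eval α • F (M.c j) (e j)
        = ∑ x ∈ Finset.univ.image M.c, F x (∑ j with M.c j = x, (M.b j).eval α • e j) := by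
      rw [← Finset.sum_fiberwise_of_maps_to (s := Finset.univ) (t := Finset.univ.image M.c)
        (g := M.c) (fun j hj => Finset.mem_image_of_mem _ hj)]
      refine Finset.sum_congr rfl fun x _ => ?_
      rw [map_sum]
      refine Finset.sum_congr rfl fun j hj => ?_
      rw [map_smul, (Finset.mem_filter.1 hj).2]
    have hcard : ((Finset.univ.image M.c).card : ℝ) ≤ s := by
      exact_mod_cast Finset.card_image_le.trans_eq (Finset.card_fin s)
    have hterm : ∀ x ∈ Finset.univ.image M.c,
        ‖F x (∑ j with M.c j = x, (M.b j).eval α • e j)‖ ≤ L * (K * D) := by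
      intro x hx
      have hx' : x ∈ Set.range M.c := by simpa using hx
      refine ((F x).le_of_opNorm_le (hL' _ _) _).trans ?_
      exact mul_le_mul_of_nonneg_left (M.norm_sum_fiber_stageError_le (hcancel x hx' α hα)
        hD₀ hK₀ hsumK hh hexp he₀) hL₀
    rw [hgroup]
    refine (norm_sum_le_of_le _ hterm).trans ?_
    rw [Finset.sum_const, nsmul_eq_mul]
    gcongr
  have hrem := M.norm_sum_aExt_smul_le (fun i α hα => (hK i α hα).2.2.2) none hα
    (by positivity) hnl
  have hsplit : ∑ j, (M.aExt none j).eval α • (P.f (t + M.c j * h) (shift r y (t + M.c j * h))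
        - P.f (t + M.c j * h) (z'.seg (some j)))
      = ∑ j, (M.b j).eval α • F (M.c j) (e j)
        + ∑ j, (M.aExt none j).eval α • (P.f (t + M.c j * h) (shift r y (t + M.c j * h))
          - P.f (t + M.c j * h) (z'.seg (some j)) - F (M.c j) (e j)) := by
    rw [← Finset.sum_add_distrib]
    refine Finset.sum_congr rfl fun j _ => ?_
    rw [smul_sub _ _ (F (M.c j) (e j))]
    exact (add_sub_cancel _ _).symm
  rw [hsplit]
  refine (norm_add_le _ _).trans ?_
  rw [norm_smul, Real.norm_of_nonneg hh.le]
  have r₂ := (norm_add_le _ _).trans (add_le_add hfib hrem)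
  have r₃ := mul_le_mul_of_nonneg_left r₂ hh.le
  have r₄ : M.remainderFactor none α * B * h ^ 4 ≤ K * B * h ^ 4 := by gcongr
  -- The quadratic remainder contributes `O(h⁵)`, one power more than needed.
  have r₅ : h * (K * (A * (6 * K * B * h ^ 2) ^ 2)) ≤ K * (A * (6 * K * B) ^ 2) * h ^ 4 := by
    have : h ^ 5 ≤ h ^ 4 := pow_le_pow_of_le_one hh.le hh₁ (by norm_num)
    have := mul_le_mul_of_nonneg_left this (by positivity : 0 ≤ K * (A * (6 * K * B) ^ 2))
    linarith
  rw [hD] at r₃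
  linarith

end OneStep

/-! ### A quadrature problem that forces `Γ₂ = 0` -/

section TestProblem

/-- The quadrature problem `y' = 2 t`. -/
def testProblem : RFDE ℝ 1 where
  f t _ := 2 * t
  continuous_f := by fun_prop
  contDiff_one _ := contDiff_const
  bounded_deriv := ⟨0, fun t φ => by
    rw [fderiv_fun_const]
    exact (norm_zero (E := History 1 ℝ →L[ℝ] ℝ)).le⟩

/-- The solution `y = t²` of the quadrature problem on `[0, 2]`. -/
def testSolution : testProblem.Solution 0 1 where
  y := ⟨fun t => t ^ 2, by fun_prop⟩
  tEnd := 2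
  t₀_lt := zero_lt_one
  T_lt := one_lt_two
  isSolution t _ := by
    simpa [testProblem] using (hasDerivAt_pow 2 t).hasDerivWithinAt

/-- The order hypotheses ask for an unknown degree of smoothness, so the test problem has to belong
to every class. -/
theorem testProblem_isOfClass (l : ℕ) : testProblem.IsOfClass l := by
  refine ⟨fun t => contDiff_const, fun k _ => ?_⟩
  rcases Nat.eq_zero_or_pos k with rfl | hk
  · exact (continuousMultilinearCurryFin0 ℝ (History 1 ℝ) ℝ).symm.continuous.comp
      testProblem.continuous_f
  · have : (fun p : ℝ × History 1 ℝ => iteratedFDeriv ℝ k (testProblem.f p.1) p.2)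
        = fun _ => 0 := by
      funext p
      exact congrFun (iteratedFDeriv_const_of_ne hk.ne' (2 * p.1)) p.2
    rw [this]
    exact continuous_const

theorem testSolution_isPiecewiseOfClass (m : ℕ) :
    IsPiecewiseOfClass m 1 (fun i => 2 * i) testSolution.y 0 testSolution.tEnd := by
  refine ⟨by simp, by simp [testSolution], fun i hi => ⟨by push_cast; linarith, ?_⟩⟩
  exact (contDiff_id.pow 2).contDiffOn

theorem testSolution_taylorBound :
    TaylorBound testSolution.y (fun t => 2 * t) (fun _ => 2) (fun _ => 0) (Set.Icc 0 2) 2 := by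
  refine taylorBound_of_hasDerivWithinAt (y₄ := fun _ => 0) (convex_Icc 0 2) zero_le_two
    (fun t _ => ?_) (fun t _ => ?_) (fun t _ => hasDerivWithinAt_const _ _ _)
    (fun t _ => hasDerivWithinAt_const _ _ _) ?_ ?_ ?_
  · exact (hasDerivAt_pow 2 t).hasDerivWithinAt.congr_deriv (by simp)
  · simpa using ((hasDerivWithinAt_id t (Set.Icc 0 2)).const_mul (2 : ℝ))
  all_goals simp

/-- If the residual of the quadrature problem is `O(h³)`, then `Γ₂ = 0`. -/
theorem Gamma_two_eq_zero (hM : M.StageOrderOne) {C h₀ : ℝ} (hh₀ : 0 < h₀)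
    (H : ∀ N : ℕ, 0 < N → ∀ h : ℝ, h = (1 - 0) / N → h < h₀ → ∀ n : ℕ, 2 ≤ n → n ≤ N →
      M.IsRegularStep 1 (fun i => 2 * i) h (0 + (n - 1) * h) →
      ∀ ω, ‖(M.exactValue (r := 1) testSolution.y h (0 + (n - 1) * h + h)).seg none ω
        - M.rhs testProblem h (0 + (n - 1) * h)
          (M.exactValue testSolution.y h (0 + (n - 1) * h))
          (M.exactValue testSolution.y h (0 + (n - 1) * h + h)) none ω‖ ≤ C * h ^ 3) :
    ∀ α ∈ Set.Icc (0 : ℝ) 1, M.Gamma none 2 α = 0 := by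
  intro α hα
  have hlim : Filter.Tendsto (fun N : ℕ => (1 : ℝ) / N) Filter.atTop (nhds 0) :=
    tendsto_one_div_atTop_nhds_zero_nat
  set κ := M.remainderFactor none α * 2
  have hlim₂ : Filter.Tendsto (fun N : ℕ => C * (1 / (N : ℝ)) + κ * (1 / (N : ℝ)) ^ 2)
      Filter.atTop (nhds 0) := by
    simpa using (hlim.const_mul C).add ((hlim.pow 2).const_mul κ)
  -- Abscissae may be large; the step `n = 2`, from `t = h`, stays in `[0, 2]` once `N` is large.
  have hreg : ∀ᶠ N : ℕ in Filter.atTop, ∀ j, (1 : ℝ) / N + M.cExt j * (1 / N) < 2 :=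
    Filter.eventually_all.2 fun j => by
      have : Filter.Tendsto (fun N : ℕ => (1 : ℝ) / N + M.cExt j * (1 / N)) Filter.atTop
          (nhds 0) := by
        simpa using hlim.add (hlim.const_mul (M.cExt j))
      exact this.eventually_lt_const two_pos
  have hle : |M.Gamma none 2 α * 2| ≤ 0 := by
    refine ge_of_tendsto hlim₂ ?_
    filter_upwards [hreg, hlim.eventually_lt_const hh₀, Filter.eventually_ge_atTop 2]
      with N hN hNh hN₂
    have hN₀ : 0 < N := by omega
    set h : ℝ := 1 / N with hh_def
    have hh : 0 < h := by positivity
    have hh₁ : h ≤ 1 := by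
      rw [hh_def, div_le_one (by positivity)]
      exact_mod_cast hN₀
    have hω : (α - 1) * h ∈ Set.Icc (-((1 : ℝ≥0) : ℝ)) 0 := by
      have := hα.1
      have := hα.2
      constructor
      · rw [NNReal.coe_one]
        nlinarith
      · nlinarith
    have htime : (0 : ℝ) + (((2 : ℕ) : ℝ) - 1) * h = h := by
      push_cast
      ring
    have hcons := H N hN₀ h (by rw [sub_zero]) hNh 2 le_rfl hN₂
    rw [htime] at hcons
    have h₁ := hcons ⟨0, one_pos, by simp, fun j => by simpa using (hN j).le⟩ ⟨_, hω⟩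
    have h₂ := M.norm_residual_add_le hM testProblem testSolution.y testSolution_taylorBound
      (fun x _ => rfl) hh (sub_self h).ge (fun j => (hN j).le) none ⟨_, hω⟩ (by
        change -(1 * h) ≤ (α - 1) * h
        nlinarith [hα.1])
    have hαω : (α - 1) * h / h + M.cExt none = α := by
      change (α - 1) * h / h + 1 = α
      field_simp
      ring
    simp only [hαω, smul_eq_mul, mul_zero, add_zero] at h₂
    -- Subtracting the residual leaves `2 h² Γ₂(α)`, bounded by `C h³ + κ h⁴`; dividing by `h²` and
    -- letting `N → ∞` at fixed `α` gives zero.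
    have h₃ := norm_sub_le_of_le h₂ h₁
    rw [add_sub_cancel_left, mul_assoc, Real.norm_eq_abs, abs_mul,
      abs_of_pos (by positivity : 0 < h ^ 2)] at h₃
    refine le_of_mul_le_mul_left (h₃.trans (le_of_eq ?_)) (by positivity : 0 < h ^ 2)
    ring
  have := abs_nonpos_iff.1 hle
  linarith

end TestProblem

/-! ### The two implications -/

theorem Gamma_two_eq_zero_of_consistency (hM : M.StageOrderOne)
    (H : M.HasUniformOrderOfConsistency 2) :
    ∀ α ∈ Set.Icc (0 : ℝ) 1, M.Gamma none 2 α = 0 := by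
  obtain ⟨l, m, H⟩ := H
  obtain ⟨C, h₀, hh₀, H⟩ := H ℝ 1 testProblem 0 1 testSolution 1 _ (testProblem_isOfClass l)
    (testSolution_isPiecewiseOfClass m)
  refine M.Gamma_two_eq_zero hM (C := C) hh₀ fun N hN h hh hlt n hn hnN hreg ω => ?_
  have hpos : 0 < h := by
    rw [hh]
    positivity
  have := H N hN h hh hlt n hn hnN hreg ω
  rw [localDiscretizationError, norm_smul, norm_inv, Real.norm_of_nonneg hpos.le,
    inv_mul_le_iff₀ hpos] at this
  exact this.trans (le_of_eq (by ring))

theorem Gamma_two_eq_zero_of_oneStepOrder (hM : M.StageOrderOne)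
    (H : M.HasUniformOneStepOrder 2) :
    ∀ α ∈ Set.Icc (0 : ℝ) 1, M.Gamma none 2 α = 0 := by
  obtain ⟨l, m, H⟩ := H
  obtain ⟨C, h₀, hh₀, H⟩ := H ℝ 1 testProblem 0 1 testSolution 1 _ (testProblem_isOfClass l)
    (testSolution_isPiecewiseOfClass m)
  refine M.Gamma_two_eq_zero hM (C := C) hh₀ fun N hN h hh hlt n hn hnN hreg ω => ?_
  obtain ⟨⟨z', hz'⟩, H⟩ := H N hN h hh hlt n hn hnN hreg
  have := H z' hz' ω
  rw [hz'.1] at this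
  -- The right-hand side `2t` ignores the history, so the step error is definitionally the residual.
  exact this

theorem hasUniformOrderOfConsistency_three (hM : M.StageOrderOne)
    (hΓ₂ : ∀ α ∈ Set.Icc (0 : ℝ) 1, M.Gamma none 2 α = 0)
    (hΓ₃ : ∀ α ∈ Set.Icc (0 : ℝ) 1, M.Gamma none 3 α = 0) :
    M.HasUniformOrderOfConsistency 3 := by
  obtain ⟨K, hK₀, hK⟩ := M.exists_coefficient_bound
  -- Only `y` is expanded here, so nothing is asked of `f` beyond continuity.
  refine ⟨0, 4, ?_⟩
  intro E _ _ _ r P t₀ T S k ξ _ hξ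
  obtain ⟨B, hB, hT⟩ := hξ.exists_taylorBound
  refine ⟨K * B, 1, one_pos, fun N hN h hh _ n _ _ hreg ω => ?_⟩
  have hpos : 0 < h := by
    have := sub_pos.2 S.t₀_lt
    rw [hh]
    positivity
  obtain ⟨i, hi, ha, hb⟩ := hreg
  obtain ⟨y₁, y₂, y₃, hy⟩ := hT i hi
  have hf := S.f_shift_eq (hξ.2.2 i hi).1 (hξ.Icc_subset hi) hy
  rw [localDiscretizationError, norm_smul, norm_inv, Real.norm_of_nonneg hpos.le,
    inv_mul_le_iff₀ hpos]
  by_cases hω : -(M.cExt none * h) ≤ (ω : ℝ)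
  · have hα := M.mem_Icc_cExt hpos none ω hω
    have r₁ := M.norm_residual_add_le hM P S.y hy hf hpos ha hb none ω hω
    rw [hΓ₂ _ hα, hΓ₃ _ hα, mul_zero, mul_zero, zero_smul, zero_smul, add_zero, add_zero] at r₁
    refine r₁.trans ?_
    have := (hK none _ hα).2.2.1
    calc _ ≤ K * B * h ^ 4 := by gcongr
      _ = _ := by ring
  · rw [M.rhs_exactValue_of_lt P S.y h _ hpos _ none ω hω, sub_self, norm_zero]
    positivity

theorem hasUniformOneStepOrder_three (hM : M.StageOrderOne)
    (hΓ₂ : ∀ α ∈ Set.Icc (0 : ℝ) 1, M.Gamma none 2 α = 0)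
    (hΓ₃ : ∀ α ∈ Set.Icc (0 : ℝ) 1, M.Gamma none 3 α = 0)
    (hcancel : ∀ cstar ∈ Set.range M.c, ∀ α ∈ Set.Icc (0 : ℝ) 1, ∀ β ∈ Set.Icc 0 cstar,
      ∑ i with M.c i = cstar, (M.b i).eval α * M.Gamma (some i) 2 β = 0)
    (H : M.HasUniformOneStepOrder 2) : M.HasUniformOneStepOrder 3 := by
  obtain ⟨K, hK₀, hK⟩ := M.exists_coefficient_bound
  obtain ⟨l, m, H⟩ := H
  refine ⟨max l 2, max m 4, ?_⟩
  intro E _ _ _ r P t₀ T S k ξ hP hξ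
  obtain ⟨C, h₀, hh₀, H⟩ := H E r P t₀ T S k ξ (hP.of_le (le_max_left _ _))
    (hξ.of_le (le_max_left _ _))
  replace hξ := hξ.of_le (le_max_right m 4)
  obtain ⟨B, hB, hT⟩ := hξ.exists_taylorBound
  obtain ⟨L, hL₀, hL', hL⟩ := P.exists_lipschitz
  obtain ⟨A, δ, hA, hδ, hlin⟩ :=
    (hP.of_le (le_max_right l 2)).exists_linearization_bound S.y t₀ S.tEnd
  -- The bounds on `h` serve, in turn, existence of the step (taken from the order-two hypothesis),
  -- comparison of powers of `h`, absorption of the stage errors, and validity of the linearization.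
  -- The added ones keep the denominators positive.
  refine ⟨K * B + s * (L * (K * (2 * K * B + 6 * K ^ 2 * L * B))) + K * (A * (6 * K * B) ^ 2),
    min h₀ (min 1 (min (1 / (2 * (K * L + 1))) (δ / (6 * K * B + 1)))), by positivity, ?_⟩
  intro N hN h hh hlt n hn hnN hreg
  obtain ⟨hlt₀, hlt₁, hlt₂, hlt₃⟩ : h < h₀ ∧ h < 1 ∧ h < 1 / (2 * (K * L + 1)) ∧
      h < δ / (6 * K * B + 1) := by simpa only [lt_min_iff] using hlt
  have hpos : 0 < h := by
    have := sub_pos.2 S.t₀_lt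
    rw [hh]
    positivity
  rw [lt_div_iff₀ (by positivity)] at hlt₂ hlt₃
  refine ⟨(H N hN h hh hlt₀ n hn hnN hreg).1, fun z' hz' ω => ?_⟩
  obtain ⟨i, hi, ha, hb⟩ := hreg
  obtain ⟨y₁, y₂, y₃, hy⟩ := hT i hi
  have hsub := hξ.Icc_subset hi
  exact M.norm_oneStepError_le hM hΓ₂ hΓ₃ hcancel hK₀ hK hL₀ hL' hL hA
    (fun x hx => hlin x (hsub hx)) hy (S.f_shift_eq (hξ.2.2 i hi).1 hsub hy) hpos hlt₁.le
    (by linarith) (by linarith) ha hb hz' ω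

end TSRK

theorem mainTheorem3 {s : ℕ} (M : TSRK s)
    (h_stage : M.StageOrderOne)
    (h_Gamma : ∀ α ∈ Set.Icc (0 : ℝ) 1, M.Gamma none 3 α = 0)
    (h_b : ∀ cstar ∈ Set.range M.c, ∀ α ∈ Set.Icc (0 : ℝ) 1, ∀ β ∈ Set.Icc 0 cstar,
      ∑ i with M.c i = cstar, (M.b i).eval α * M.Gamma (some i) 2 β = 0) :
    (M.HasUniformOrderOfConsistency 2 → M.HasUniformOrderOfConsistency 3) ∧
    (M.HasUniformOneStepOrder 2 → M.HasUniformOneStepOrder 3) :=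
  ⟨fun H => M.hasUniformOrderOfConsistency_three h_stage
      (M.Gamma_two_eq_zero_of_consistency h_stage H) h_Gamma,
    fun H => M.hasUniformOneStepOrder_three h_stage
      (M.Gamma_two_eq_zero_of_oneStepOrder h_stage H) h_Gamma h_b H⟩
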